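/- Let $P$ be the powerset monad on $\mathbf{Set}$, and let $T$ be either the non-empty finite powerset monad $Q$ or the finitely supported probability distribution monad $D$. Let $\delta:TP\to PT$ be the weak distributive law given by $$\delta(\{U_i\}_{i})=\{\textstyle\bigcup_i V_i\mid \emptyset\neq V_i\subseteq U_i,\ V_i\text{ finite}\}\ \ (T=Q),\qquad \delta([U_i\mapsto p_i]_i)=\{\mu^D[\varphi_i\mapsto p_i]\mid \mathrm{supp}\,\varphi_i\subseteq U_i\}\ \ (T=D).$$ Let $\widetilde{PT}$ be the associated composite monad: $\widetilde{PT}(Y)$ is the set of those $\mathcal U\subseteq T(Y)$ which are convex, i.e. fixed by the closure operator $P\mu^T\circ\delta T\circ\eta^T PT$; its unit is $\eta^P\eta^T$ and its multiplication is $\mu^P\mu^T\circ P\delta$. Write $\odot$ for composition in the Kleisli category $\mathbf{Kl}(\widetilde{PT})$, and $J:\mathbf{Set}\to\mathbf{Kl}(\widetilde{PT})$, $J(f)=\overline f=\eta\circ f$. Let $A,B,X$ be sets, $H(Y)=B+A\times Y$ and $H_X(Y)=X\times H(Y)$. Let $\overline H,\overline{H_X}$ be the extensions of $H,H_X$ to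 $\mathbf{Kl}(\widetilde{PT})$ given by the canonical distributive laws of these functors over $\widetilde{PT}$ (built from the unit and the strength). Let $A^*B$ and $(XA)^*XB$ be the sets of words $a_1\cdots a_nb$ and $x_0a_1x_1\cdots a_nx_nb$ ($n\ge 0$), with their evident algebra structures $\alpha:H(A^*B)\cong A^*B$ and $\alpha_X:H_X((XA)^*XB)\cong(XA)^*XB$. For $c:X\to\widetilde{PT}(H(X))$ let $c^*=\mathsf{stl}\circ\langle\mathrm{id},c\rangle:X\to\widetilde{PT}(H_X(X))$. Then $(A^*B,\alpha)$ and $((XA)^*XB,\alpha_X)$ are an initial $H$-algebra and an initial $H_X$-algebra, and $J(\alpha^{-1})$ and $J(\alpha_X^{-1})$ are a final $\overline H$-coalgebra and a final $\overline{H_X}$-coalgebra. Hence every $c:X\to\widetilde{PT}(H(X))$ has a trace map $\mathsf{tr}_c:X\to\widetilde{PT}(A^*B)$, the unique $\overline H$-coalgebra morphism from $c$ to $J(\alpha^{-1})$, and an execution map $\mathsf{exec}_c:X\to\widetilde{PT}((XA)^*XB)$, the unique $\overline{H_X}$-coalgebra morphism from $c^*$ to $J(\alpha_X^{-1})$. The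 projection $\pi_2:H_X\to H$ is a natural transformation, and so is $\overline{\pi_2}:\overline{H_X}\to\overline H$, with components $J(\pi_2)$. The former induces a function $f_{\pi_2}:(XA)^*XB\to A^*B$, the unique $H_X$-algebra morphism from $\alpha_X$ to $\alpha\circ\pi_2$; the latter induces a Kleisli morphism $f_{\overline{\pi_2}}$, the unique $\overline H$-coalgebra morphism from $\overline{\pi_2}\odot J(\alpha_X^{-1})$ to $J(\alpha^{-1})$. They satisfy $f_{\overline{\pi_2}}=J(f_{\pi_2})$, and $$f_{\overline{\pi_2}}\odot\mathsf{exec}_c=\mathsf{tr}_c\qquad\text{for every } c:X\to\widetilde{PT}(H(X)).$$ -/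

import Mathlib

open CategoryTheory CategoryTheory.Limits CategoryTheory.Endofunctor

universe u

namespace GameTraces

noncomputable section

/-! ### Environment monads -/

/-- The support map `supp : T → P` of an environment monad, together with the elementary facts
which make the composite with the powerset monad a monad. It is only used for the two monads
`FinPow` and `Dist` below, for which every field is proved. -/
class HasSupp (T : Type u → Type u) [Monad T] where
  /-- The support. -/
  supp : ∀ {X : Type u}, T X → Set X
  supp_nonempty : ∀ {X : Type u} (t : T X), (supp t).Nonempty
  supp_pure : ∀ {X : Type u} (x : X), supp (pure x : T X) = {x}
  supp_bind : ∀ {X Y : Type u} (t : T X) (f : X → T Y),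
    supp (t >>= f) = ⋃ x ∈ supp t, supp (f x)
  bind_ext : ∀ {X Y : Type u} (t : T X) (f g : X → T Y),
    (∀ x ∈ supp t, f x = g x) → t >>= f = t >>= g
  bind_const : ∀ {X Y : Type u} (t : T X) (s : T Y), (t >>= fun _ => s) = s
  exists_fibre : ∀ {X Y : Type u} (t : T X) (g : X → Y), ∃ k : Y → T X,
    (∀ x ∈ supp t, ∀ z ∈ supp (k (g x)), z ∈ supp t ∧ g z = g x) ∧
    (t >>= fun x => k (g x)) = t

/-- The non-empty finite powerset `Q X`. -/
@[ext] structure FinPow (X : Type u) : Type u where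
  carrier : Set X
  finite : carrier.Finite
  nonempty : carrier.Nonempty

/-- The unit of `Q` is the singleton, and `bind` is the union (so that the multiplication is the
union of a finite set of finite sets). -/
instance : Monad FinPow.{u} where
  pure x := ⟨{x}, Set.finite_singleton x, Set.singleton_nonempty x⟩
  bind s f := ⟨⋃ x ∈ s.carrier, (f x).carrier, s.finite.biUnion fun x _ => (f x).finite, by
    obtain ⟨x, hx⟩ := s.nonempty
    obtain ⟨y, hy⟩ := (f x).nonempty
    exact ⟨y, Set.mem_biUnion hx hy⟩⟩

theorem FinPow.carrier_pure {X : Type u} (x : X) : (pure x : FinPow X).carrier = {x} := rfl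

theorem FinPow.carrier_bind {X Y : Type u} (s : FinPow X) (f : X → FinPow Y) :
    (s >>= f).carrier = ⋃ x ∈ s.carrier, (f x).carrier := rfl

instance : LawfulMonad FinPow.{u} := LawfulMonad.mk'
  (id_map := fun x => by
    refine FinPow.ext ?_
    change ⋃ y ∈ x.carrier, {y} = x.carrier
    simp)
  (pure_bind := fun x f => by
    refine FinPow.ext ?_
    simp [FinPow.carrier_bind, FinPow.carrier_pure])
  (bind_assoc := fun x f g => by
    refine FinPow.ext ?_
    ext z
    simp only [FinPow.carrier_bind, Set.mem_iUnion]
    grind)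

instance : HasSupp FinPow.{u} where
  supp s := s.carrier
  supp_nonempty s := s.nonempty
  supp_pure _ := rfl
  supp_bind _ _ := rfl
  bind_ext t f g h := by
    refine FinPow.ext ?_
    simp only [FinPow.carrier_bind]
    exact Set.iUnion₂_congr fun x hx => by rw [h x hx]
  bind_const t s := by
    refine FinPow.ext ?_
    rw [FinPow.carrier_bind, Set.biUnion_const t.nonempty]
  exists_fibre t g := by
    have hk : ∀ y, ∃ k : FinPow _, (∃ x ∈ t.carrier, g x = y) →
        k.carrier = {x ∈ t.carrier | g x = y} := by
      intro y
      by_cases h : ∃ x ∈ t.carrier, g x = y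
      · exact ⟨⟨_, t.finite.subset (Set.sep_subset _ _), h⟩, fun _ => rfl⟩
      · exact ⟨t, fun h' => absurd h' h⟩
    choose k hk using hk
    refine ⟨k, ?_, ?_⟩
    · intro x hx z hz
      rwa [hk _ ⟨x, hx, rfl⟩] at hz
    · refine FinPow.ext ?_
      rw [FinPow.carrier_bind]
      ext z
      simp only [Set.mem_iUnion]
      constructor
      · rintro ⟨x, hx, hz⟩
        rw [hk _ ⟨x, hx, rfl⟩] at hz
        exact hz.1
      · intro hz
        exact ⟨z, hz, by rw [hk _ ⟨z, hz, rfl⟩]; exact ⟨hz, rfl⟩⟩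

/-- The finite distributions `D X`: probability distributions with finite support. -/
structure Dist (X : Type u) : Type u where
  pmf : PMF X
  finite : pmf.support.Finite

theorem Dist.ext {X : Type u} {p q : Dist X} (h : p.pmf = q.pmf) : p = q := by
  cases p; cases q; cases h; rfl

/-- The unit of `D` is the Dirac distribution, and `bind` is the averaging of distributions. -/
instance : Monad Dist.{u} where
  pure x := ⟨PMF.pure x, by rw [PMF.support_pure]; exact Set.finite_singleton x⟩
  bind p f := ⟨p.pmf.bind fun x => (f x).pmf, by
    rw [PMF.support_bind]; exact p.finite.biUnion fun x _ => (f x).finite⟩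

theorem Dist.pmf_pure {X : Type u} (x : X) : (pure x : Dist X).pmf = PMF.pure x := rfl

theorem Dist.pmf_bind {X Y : Type u} (p : Dist X) (f : X → Dist Y) :
    (p >>= f).pmf = p.pmf.bind fun x => (f x).pmf := rfl

instance : LawfulMonad Dist.{u} := LawfulMonad.mk'
  (id_map := fun x => Dist.ext (PMF.bind_pure x.pmf))
  (pure_bind := fun x _ => Dist.ext (PMF.pure_bind x _))
  (bind_assoc := fun x _ _ => Dist.ext (PMF.bind_bind x.pmf _ _))

instance : HasSupp Dist.{u} where
  supp p := p.pmf.support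
  supp_nonempty p := p.pmf.support_nonempty
  supp_pure x := PMF.support_pure x
  supp_bind p _ := PMF.support_bind p.pmf _
  bind_ext t f g h := by
    refine Dist.ext (PMF.ext fun b => ?_)
    simp only [Dist.pmf_bind, PMF.bind_apply]
    refine tsum_congr fun a => ?_
    by_cases ha : a ∈ t.pmf.support
    · rw [h a ha]
    · rw [(PMF.apply_eq_zero_iff _ _).2 ha, zero_mul, zero_mul]
  bind_const t s := Dist.ext (PMF.bind_const _ _)
  exists_fibre t g := by
    have hk : ∀ y, ∃ k : Dist _, ∀ h : (∃ x ∈ g ⁻¹' {y}, x ∈ t.pmf.support),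
        k.pmf = t.pmf.filter (g ⁻¹' {y}) h := by
      intro y
      by_cases h : ∃ x ∈ g ⁻¹' {y}, x ∈ t.pmf.support
      · exact ⟨⟨t.pmf.filter (g ⁻¹' {y}) h, by
          rw [PMF.support_filter]; exact t.finite.subset Set.inter_subset_right⟩,
          fun _ => rfl⟩
      · exact ⟨t, fun h' => absurd h' h⟩
    choose k hk using hk
    refine ⟨k, ?_, ?_⟩
    · intro x hx z hz
      rw [hk _ ⟨x, rfl, hx⟩, PMF.mem_support_filter_iff] at hz
      exact ⟨hz.2, hz.1⟩
    · refine Dist.ext (PMF.ext fun z => ?_)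
      rw [Dist.pmf_bind, PMF.bind_apply]
      have key : ∀ x, t.pmf x * (k (g x)).pmf z = (g ⁻¹' {g z}).indicator t.pmf x *
          (t.pmf z * (∑' x', (g ⁻¹' {g z}).indicator t.pmf x')⁻¹) := by
        intro x
        by_cases hx : x ∈ t.pmf.support
        · rw [hk _ ⟨x, rfl, hx⟩, PMF.filter_apply]
          by_cases hz : g x = g z
          · rw [hz, Set.indicator_of_mem (show z ∈ g ⁻¹' {g z} from rfl),
              Set.indicator_of_mem (show x ∈ g ⁻¹' {g z} from hz)]
          · rw [Set.indicator_of_notMem (show z ∉ g ⁻¹' {g x} from fun h => hz (Eq.symm h)),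
              Set.indicator_of_notMem (show x ∉ g ⁻¹' {g z} from hz)]
            simp
        · have h0 : t.pmf x = 0 := (PMF.apply_eq_zero_iff _ _).2 hx
          rw [h0, zero_mul]
          by_cases hz : x ∈ g ⁻¹' {g z}
          · rw [Set.indicator_of_mem hz, h0, zero_mul]
          · rw [Set.indicator_of_notMem hz, zero_mul]
      rw [tsum_congr key, ENNReal.tsum_mul_right]
      by_cases hz : t.pmf z = 0
      · rw [hz]; simp
      · have hne : (∑' x', (g ⁻¹' {g z}).indicator t.pmf x') ≠ 0 := by
          intro h
          have := ENNReal.tsum_eq_zero.1 h z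
          rw [Set.indicator_of_mem (show z ∈ g ⁻¹' {g z} from rfl)] at this
          exact hz this
        have htop : (∑' x', (g ⁻¹' {g z}).indicator t.pmf x') ≠ ⊤ := by
          refine ne_top_of_le_ne_top ENNReal.one_ne_top ?_
          rw [← t.pmf.tsum_coe]
          exact ENNReal.tsum_le_tsum fun x => Set.indicator_le_self _ _ x
        rw [mul_comm (t.pmf z), ← mul_assoc, ENNReal.mul_inv_cancel hne htop, one_mul]

/-- The two kinds of environment: nondeterministic and probabilistic. -/
inductive EnvKind
  | nondeterministic
  | probabilistic

/-- The environment monad: `Q` in the nondeterministic and `D` in the probabilistic case. -/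
def EnvKind.T : EnvKind → Type u → Type u
  | nondeterministic => FinPow
  | probabilistic => Dist

instance (e : EnvKind) : Monad e.T.{u} :=
  match e with
  | .nondeterministic => inferInstanceAs (Monad FinPow)
  | .probabilistic => inferInstanceAs (Monad Dist)

instance (e : EnvKind) : LawfulMonad e.T.{u} :=
  match e with
  | .nondeterministic => inferInstanceAs (LawfulMonad FinPow)
  | .probabilistic => inferInstanceAs (LawfulMonad Dist)

instance (e : EnvKind) : HasSupp e.T.{u} :=
  match e with
  | .nondeterministic => inferInstanceAs (HasSupp FinPow)
  | .probabilistic => inferInstanceAs (HasSupp Dist)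

/-! ### The composite of the powerset monad with an environment monad -/

section Composite

set_option linter.unusedSectionVars false

variable {T : Type u → Type u} [Monad T] [LawfulMonad T] [HasSupp T] {X Y Z : Type u}

open HasSupp

theorem exists_choice (t : T X) {R : X → Y → Prop} (h : ∀ x ∈ supp t, ∃ y, R x y) :
    ∃ φ : X → Y, ∀ x ∈ supp t, R x (φ x) := by
  obtain ⟨x₀, hx₀⟩ := supp_nonempty t
  obtain ⟨y₀, -⟩ := h x₀ hx₀
  have : ∀ x, ∃ y, x ∈ supp t → R x y := by
    intro x
    by_cases hx : x ∈ supp t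
    · exact (h x hx).imp fun _ hy _ => hy
    · exact ⟨y₀, fun hx' => absurd hx' hx⟩
  choose φ hφ using this
  exact ⟨φ, hφ⟩

/-- The multiplication of the environment monad. -/
def mulT (Φ : T (T X)) : T X := Φ >>= id

/-- The weak distributive law `δ : T P → P T`. Here `φ U` is an element of `T X` supported in `U`,
for every `U` in the support of `Φ`. For `T = Q` this reads
`δ {Uᵢ} = {⋃ᵢ Vᵢ | ∅ ≠ Vᵢ ⊆ Uᵢ finite}`, and for `T = D` it reads
`δ [Uᵢ ↦ pᵢ] = {μ [φᵢ ↦ pᵢ] | supp φᵢ ⊆ Uᵢ}`. -/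
def delta (Φ : T (Set X)) : Set (T X) :=
  {t | ∃ φ : Set X → T X, (∀ U ∈ supp Φ, supp (φ U) ⊆ U) ∧ t = Φ >>= φ}

/-- The convex closure operator `cl = P μ ∘ δ T ∘ η P T`. -/
def cl (𝒰 : Set (T X)) : Set (T X) := mulT '' delta (pure 𝒰 : T (Set (T X)))

theorem mem_cl {𝒰 : Set (T X)} {t : T X} :
    t ∈ cl 𝒰 ↔ ∃ Φ : T (T X), supp Φ ⊆ 𝒰 ∧ t = mulT Φ := by
  constructor
  · rintro ⟨_, ⟨φ, hφ, rfl⟩, rfl⟩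
    exact ⟨φ 𝒰, hφ 𝒰 (by rw [supp_pure]; rfl), by rw [pure_bind]⟩
  · rintro ⟨Φ, hΦ, rfl⟩
    refine ⟨Φ, ⟨fun _ => Φ, fun U hU => ?_, by rw [pure_bind]⟩, rfl⟩
    rw [supp_pure] at hU
    exact (Set.mem_singleton_iff.1 hU) ▸ hΦ

theorem subset_cl (𝒰 : Set (T X)) : 𝒰 ⊆ cl 𝒰 := fun t ht =>
  mem_cl.2 ⟨pure t, by rw [supp_pure]; simpa using ht, by simp [mulT]⟩

/-- The sets which are convex, that is, fixed by the closure operator. -/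
def IsConvex (𝒰 : Set (T X)) : Prop := cl 𝒰 = 𝒰

theorem isConvex_iff {𝒰 : Set (T X)} :
    IsConvex 𝒰 ↔ ∀ Φ : T (T X), supp Φ ⊆ 𝒰 → mulT Φ ∈ 𝒰 := by
  constructor
  · intro h Φ hΦ
    have : mulT Φ ∈ cl 𝒰 := mem_cl.2 ⟨Φ, hΦ, rfl⟩
    rwa [h] at this
  · intro h
    refine Set.Subset.antisymm (fun t ht => ?_) (subset_cl 𝒰)
    obtain ⟨Φ, hΦ, rfl⟩ := mem_cl.1 ht
    exact h Φ hΦ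

theorem IsConvex.bind_mem {𝒰 : Set (T X)} (h : IsConvex 𝒰) (t : T Y) (φ : Y → T X)
    (hφ : ∀ y ∈ supp t, φ y ∈ 𝒰) : t >>= φ ∈ 𝒰 := by
  have := isConvex_iff.1 h (t >>= fun y => pure (φ y)) (by
    rw [supp_bind]
    intro z hz
    simp only [Set.mem_iUnion, supp_pure] at hz
    obtain ⟨y, hy, rfl⟩ := hz
    exact hφ y hy)
  simpa [mulT] using this

theorem regroup (t : T X) (f : X → T Y) (χ : X → Y → T Z) (C : Y → Set (T Z))
    (hC : ∀ y, IsConvex (C y)) (h : ∀ x ∈ supp t, ∀ y ∈ supp (f x), χ x y ∈ C y) :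
    ∃ ψ : Y → T Z, (∀ y ∈ supp (t >>= f), ψ y ∈ C y) ∧
      (t >>= fun x => f x >>= χ x) = (t >>= f) >>= ψ := by
  have hw : ∀ p, p ∈ supp (t >>= fun x => f x >>= fun y => pure (x, y)) ↔
      p.1 ∈ supp t ∧ p.2 ∈ supp (f p.1) := by
    rintro ⟨x, y⟩
    simp only [supp_bind, supp_pure, Set.mem_iUnion, Set.mem_singleton_iff, Prod.mk.injEq]
    grind
  obtain ⟨k, hk, hkw⟩ := exists_fibre (t >>= fun x => f x >>= fun y => pure (x, y)) Prod.snd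
  refine ⟨fun y => k y >>= fun p => χ p.1 p.2, ?_, ?_⟩
  · intro y hy
    rw [supp_bind] at hy
    simp only [Set.mem_iUnion] at hy
    obtain ⟨x, hx, hxy⟩ := hy
    refine (hC y).bind_mem _ _ fun p hp => ?_
    obtain ⟨hp1, hp2⟩ := hk (x, y) ((hw _).2 ⟨hx, hxy⟩) p hp
    have hp3 : p.2 = y := hp2
    rw [← hp3]
    exact h _ ((hw _).1 hp1).1 _ ((hw _).1 hp1).2
  · have := congrArg (fun w => w >>= fun p => χ p.1 p.2) hkw
    simp only [bind_assoc, pure_bind] at this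
    rw [bind_assoc]
    exact this.symm

variable (T) in
/-- The functor part of the composite monad on objects: the convex elements of `P (T X)`. -/
structure Comp (X : Type u) : Type u where
  sets : Set (T X)
  convex : IsConvex sets

namespace Comp

theorem ext {𝒰 𝒱 : Comp T X} (h : ∀ t, t ∈ 𝒰.sets ↔ t ∈ 𝒱.sets) : 𝒰 = 𝒱 := by
  cases 𝒰; cases 𝒱; cases Set.ext h; rfl

/-- The functor part of the composite monad on functions: the restriction of `P (T f)`. -/
def map (f : X → Y) (𝒰 : Comp T X) : Comp T Y where
  sets := (fun t => f <$> t) '' 𝒰.sets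
  convex := by
    rw [isConvex_iff]
    intro Φ hΦ
    obtain ⟨s, hs⟩ := exists_choice Φ (R := fun t s => s ∈ 𝒰.sets ∧ f <$> s = t)
      fun t ht => hΦ ht
    refine ⟨Φ >>= s, 𝒰.convex.bind_mem Φ s fun t ht => (hs t ht).1, ?_⟩
    simp only [map_bind, mulT]
    exact bind_ext Φ _ _ fun t ht => (hs t ht).2

/-- The unit `η η` of the composite monad: `x ↦ {η x}`. -/
def unit (x : X) : Comp T X where
  sets := {pure x}
  convex := by
    rw [isConvex_iff]
    intro Φ hΦ
    have : mulT Φ = Φ >>= fun _ => pure x := bind_ext Φ _ _ fun t ht => hΦ ht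
    rw [this, bind_const]
    rfl

/-- The expression `μ μ ∘ P δ` for the multiplication of the composite monad. -/
def mulSet (𝔘 : Comp T (Comp T X)) : Set (T X) :=
  ⋃ Θ ∈ 𝔘.sets, mulT '' delta (Comp.sets <$> Θ)

theorem mem_mulSet {𝔘 : Comp T (Comp T X)} {t : T X} :
    t ∈ mulSet 𝔘 ↔ ∃ Θ ∈ 𝔘.sets, ∃ ψ : Comp T X → T X,
      (∀ 𝒱 ∈ supp Θ, ψ 𝒱 ∈ 𝒱.sets) ∧ t = Θ >>= ψ := by
  have hsupp : ∀ Θ : T (Comp T X), supp (Comp.sets <$> Θ) = Comp.sets '' supp Θ := by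
    intro Θ
    rw [← bind_pure_comp, supp_bind]
    ext V
    simp [supp_pure, eq_comm]
  simp only [mulSet, Set.mem_iUnion, exists_prop]
  refine exists_congr fun Θ => and_congr_right fun _ => ?_
  constructor
  · rintro ⟨_, ⟨φ, hφ, rfl⟩, rfl⟩
    refine ⟨fun 𝒱 => mulT (φ 𝒱.sets), fun 𝒱 h𝒱 => ?_, ?_⟩
    · exact isConvex_iff.1 𝒱.convex _ (hφ _ (by rw [hsupp]; exact ⟨𝒱, h𝒱, rfl⟩))
    · simp [mulT]
  · rintro ⟨ψ, hψ, rfl⟩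
    classical
    refine ⟨Comp.sets <$> Θ >>= fun V => if h : IsConvex V then pure (ψ ⟨V, h⟩)
      else pure (Θ >>= ψ), ⟨_, ?_, rfl⟩, ?_⟩
    · rw [hsupp]
      rintro _ ⟨𝒱, h𝒱, rfl⟩
      rw [dif_pos 𝒱.convex, supp_pure]
      exact Set.singleton_subset_iff.2 (hψ 𝒱 h𝒱)
    · simp [mulT, Comp.convex]

/-- The multiplication of the composite monad. -/
def mul (𝔘 : Comp T (Comp T X)) : Comp T X where
  sets := mulSet 𝔘
  convex := by
    rw [isConvex_iff]
    intro Φ hΦ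
    obtain ⟨Θ, hΘ⟩ := exists_choice Φ fun t ht => mem_mulSet.1 (hΦ ht)
    obtain ⟨ψ, hψ⟩ := exists_choice Φ fun t ht => (hΘ t ht).2
    obtain ⟨ω, hω, h⟩ := regroup Φ Θ ψ Comp.sets Comp.convex fun t ht => (hψ t ht).1
    refine mem_mulSet.2 ⟨Φ >>= Θ, 𝔘.convex.bind_mem _ _ fun t ht => (hΘ t ht).1, ω, hω, ?_⟩
    rw [← h]
    exact bind_ext _ _ _ fun t ht => (hψ t ht).2

/-- The composite monad, with Kleisli extension `μ ∘ map f`. -/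
instance : Monad (Comp T) where
  pure := unit
  map := map
  bind 𝒰 f := mul (map f 𝒰)

theorem mem_pure {x : X} {t : T X} : t ∈ (pure x : Comp T X).sets ↔ t = pure x := Iff.rfl

theorem mem_map {f : X → Y} {𝒰 : Comp T X} {t : T Y} :
    t ∈ (f <$> 𝒰).sets ↔ ∃ s ∈ 𝒰.sets, f <$> s = t := Iff.rfl

theorem mem_bind {𝒰 : Comp T X} {f : X → Comp T Y} {t : T Y} :
    t ∈ (𝒰 >>= f).sets ↔ ∃ s ∈ 𝒰.sets, ∃ φ : X → T Y,
      (∀ x ∈ supp s, φ x ∈ (f x).sets) ∧ t = s >>= φ := by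
  refine Iff.trans (mem_mulSet (𝔘 := map f 𝒰)) ?_
  constructor
  · rintro ⟨_, ⟨s, hs, rfl⟩, ψ, hψ, rfl⟩
    refine ⟨s, hs, fun x => ψ (f x), fun x hx => hψ _ ?_, by simp⟩
    change f x ∈ supp (f <$> s)
    rw [← bind_pure_comp, supp_bind]
    simp only [supp_pure, Set.mem_iUnion]
    exact ⟨x, hx, rfl⟩
  · rintro ⟨s, hs, φ, hφ, rfl⟩
    obtain ⟨ψ, hψ, h⟩ := regroup s (fun x => pure (f x)) (fun x _ => φ x) Comp.sets Comp.convex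
      (by
        intro x hx y hy
        rw [supp_pure] at hy
        rw [Set.mem_singleton_iff.1 hy]
        exact hφ x hx)
    simp only [pure_bind, bind_pure_comp] at h hψ
    exact ⟨_, ⟨s, hs, rfl⟩, ψ, hψ, h⟩

instance : LawfulMonad (Comp T) := LawfulMonad.mk'
  (id_map := fun 𝒰 => Comp.ext fun t => by simp [mem_map])
  (pure_bind := fun x f => Comp.ext fun t => by
    simp only [mem_bind, mem_pure]
    constructor
    · rintro ⟨_, rfl, φ, hφ, rfl⟩
      rw [pure_bind]
      exact hφ x (by rw [supp_pure]; rfl)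
    · intro ht
      refine ⟨_, rfl, fun _ => t, fun y hy => ?_, by rw [pure_bind]⟩
      rw [supp_pure] at hy
      rwa [Set.mem_singleton_iff.1 hy])
  (bind_assoc := fun 𝒰 f g => Comp.ext fun t => by
    simp only [mem_bind]
    constructor
    · rintro ⟨_, ⟨s, hs, φ, hφ, rfl⟩, χ, hχ, rfl⟩
      refine ⟨s, hs, fun x => φ x >>= χ, fun x hx => ⟨φ x, hφ x hx, χ, fun y hy => hχ y ?_, rfl⟩,
        bind_assoc _ _ _⟩
      rw [supp_bind]
      exact Set.mem_biUnion hx hy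
    · rintro ⟨s, hs, ω, hω, rfl⟩
      obtain ⟨φ, hφ⟩ := exists_choice s hω
      obtain ⟨χ, hχ⟩ := exists_choice s fun x hx => (hφ x hx).2
      obtain ⟨ψ, hψ, h⟩ := regroup s φ χ (fun y => (g y).sets) (fun y => (g y).convex)
        fun x hx => (hχ x hx).1
      refine ⟨_, ⟨s, hs, φ, fun x hx => (hφ x hx).1, rfl⟩, ψ, hψ, ?_⟩
      rw [← h]
      exact bind_ext _ _ _ fun x hx => (hχ x hx).2)
  (bind_pure_comp := fun f 𝒰 => Comp.ext fun t => by
    simp only [mem_bind, mem_map, mem_pure]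
    refine exists_congr fun s => and_congr_right fun _ => ?_
    constructor
    · rintro ⟨φ, hφ, rfl⟩
      rw [← bind_pure_comp]
      exact (bind_ext _ _ _ hφ).symm
    · rintro rfl
      exact ⟨fun x => pure (f x), fun _ _ => rfl, by rw [bind_pure_comp]⟩)

end Comp

end Composite

/-! ### The functors `H` and `H_X`, and their initial algebras -/

section Functors

variable (A B X : Type u)

/-- The linear functor `H Y = B + A × Y`. -/
def linFun : Type u ⥤ Type u where
  obj Y := B ⊕ A × Y
  map f := ↾(Sum.map id (Prod.map id f))
  map_id Y := by ext (_ | _) <;> rfl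
  map_comp f g := by ext (_ | _) <;> rfl

/-- The linear functor `H_X Y = X × H Y`. -/
def linFunX : Type u ⥤ Type u where
  obj Y := X × (B ⊕ A × Y)
  map f := ↾(Prod.map id (Sum.map id (Prod.map id f)))
  map_id Y := by ext ⟨_, (_ | _)⟩ <;> rfl
  map_comp f g := by ext ⟨_, (_ | _)⟩ <;> rfl

/-- The projection `π₂ : H_X → H`. -/
def projTwo : linFunX A B X ⟶ linFun A B where
  app Y := ↾(Prod.snd : X × (B ⊕ A × Y) → B ⊕ A × Y)

/-- The finite traces `A* B`: the words `a₁ ⋯ aₙ b` with `n ≥ 0`. -/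
abbrev Traces : Type u := List A × B

/-- The executions `(X A)* X B`: the words `x₀ a₁ x₁ ⋯ aₙ xₙ b` with `n ≥ 0`, bracketed as
`(x₀ a₁) (x₁ a₂) ⋯ (xₙ b)`. -/
abbrev Execs : Type u := List (X × A) × (X × B)

/-- The bijection `H (A* B) ≅ A* B`, sending `b` to the word `b`, and `(a, w)` to `a w`. -/
def tracesEquiv : B ⊕ A × Traces A B ≃ Traces A B where
  toFun
    | .inl b => ([], b)
    | .inr (a, (l, b)) => (a :: l, b)
  invFun
    | ([], b) => .inl b
    | (a :: l, b) => .inr (a, (l, b))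
  left_inv := by rintro (_ | ⟨_, _, _⟩) <;> rfl
  right_inv := by rintro ⟨_ | _, _⟩ <;> rfl

/-- The bijection `H_X ((X A)* X B) ≅ (X A)* X B`, sending `(x, b)` to the word `x b`, and
`(x, (a, w))` to `x a w`. -/
def execsEquiv : X × (B ⊕ A × Execs A B X) ≃ Execs A B X where
  toFun
    | (x, .inl b) => ([], (x, b))
    | (x, .inr (a, (l, e))) => ((x, a) :: l, e)
  invFun
    | ([], (x, b)) => (x, .inl b)
    | ((x, a) :: l, e) => (x, .inr (a, (l, e)))
  left_inv := by rintro ⟨_, (_ | ⟨_, _, _⟩)⟩ <;> rfl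
  right_inv := by rintro ⟨_ | _, _⟩ <;> rfl

/-- The `H`-algebra `A* B`. -/
def tracesAlg : Algebra (linFun A B) where
  a := Traces A B
  str := ↾(tracesEquiv A B)

/-- The `H_X`-algebra `(X A)* X B`. -/
def execsAlg : Algebra (linFunX A B X) where
  a := Execs A B X
  str := ↾(execsEquiv A B X)

end Functors

/-! ### Extensions to Kleisli categories -/

section Kleisli

set_option linter.unusedSectionVars false

variable (M : Type u → Type u) [Monad M] [LawfulMonad M] (A B X : Type u)

/-- The functor `J : Set → Kl(M)`, `J f = η ∘ f`. -/
def kleisliJ : Type u ⥤ KleisliCat M where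
  obj Y := Y
  map f := fun y => (pure (f y) : M _)
  map_id _ := rfl
  map_comp f g := by
    funext x
    change pure (g (f x)) = (pure (f x) : M _) >>= fun y => pure (g y)
    rw [pure_bind]

variable {M A B X}

/-- The left strength of the monad. -/
def stl {Y Z : Type u} (p : Y × M Z) : M (Y × Z) := Prod.mk p.1 <$> p.2

/-- The distributive law `λ : B + A × M Y → M (B + A × Y)`. -/
def lam {Y : Type u} : B ⊕ A × M Y → M (B ⊕ A × Y)
  | .inl b => pure (.inl b)
  | .inr p => Sum.inr <$> stl p

/-- The distributive law `X × (B + A × M Y) → M (X × (B + A × Y))`. -/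
def lamX {Y : Type u} (p : X × (B ⊕ A × M Y)) : M (X × (B ⊕ A × Y)) := stl (p.1, lam p.2)

/-- The function `λ ∘ H f`. -/
def extMap {Y Z : Type u} (f : Y → M Z) (h : B ⊕ A × Y) : M (B ⊕ A × Z) :=
  lam (Sum.map id (Prod.map id f) h)

/-- The function `λ ∘ H_X f`. -/
def extMapX {Y Z : Type u} (f : Y → M Z) (h : X × (B ⊕ A × Y)) : M (X × (B ⊕ A × Z)) :=
  lamX (Prod.map id (Sum.map id (Prod.map id f)) h)

theorem extMap_inl {Y Z : Type u} (f : Y → M Z) (b : B) :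
    extMap f (.inl b : B ⊕ A × Y) = pure (.inl b) := rfl

theorem extMap_inr {Y Z : Type u} (f : Y → M Z) (a : A) (y : Y) :
    extMap f (.inr (a, y) : B ⊕ A × Y) = (fun z => .inr (a, z)) <$> f y := by
  simp [extMap, lam, stl]

theorem extMapX_mk {Y Z : Type u} (f : Y → M Z) (x : X) (h : B ⊕ A × Y) :
    extMapX f (x, h) = (fun z => (x, z)) <$> extMap f h := rfl

theorem extMap_pure {Y : Type u} (h : B ⊕ A × Y) : extMap (M := M) pure h = pure h := by
  rcases h with b | ⟨a, y⟩
  · rfl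
  · simp [extMap_inr]

theorem extMap_bind {Y Z W : Type u} (f : Y → M Z) (g : Z → M W) (h : B ⊕ A × Y) :
    extMap (fun y => f y >>= g) h = extMap f h >>= extMap g := by
  rcases h with b | ⟨a, y⟩
  · simp [extMap_inl]
  · simp [extMap_inr]

theorem extMapX_pure {Y : Type u} (h : X × (B ⊕ A × Y)) :
    extMapX (M := M) pure h = pure h := by
  rw [extMapX_mk, extMap_pure, map_pure]

theorem extMapX_bind {Y Z W : Type u} (f : Y → M Z) (g : Z → M W) (h : X × (B ⊕ A × Y)) :
    extMapX (fun y => f y >>= g) h = extMapX f h >>= extMapX g := by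
  rw [extMapX_mk, extMap_bind, extMapX_mk]
  simp only [map_bind, bind_map_left]
  rfl

theorem extMapX_snd {Y Z : Type u} (f : Y → M Z) (h : X × (B ⊕ A × Y)) :
    (extMapX f h >>= fun p => pure p.2) = (pure h.2 : M _) >>= extMap f := by
  rw [extMapX_mk, pure_bind]
  simp

variable (M A B X)

/-- The extension of `H` to the Kleisli category, `f ↦ λ ∘ H f`. -/
def linExt : KleisliCat M ⥤ KleisliCat M where
  obj Y := (B ⊕ A × Y : Type u)
  map f := extMap f
  map_id _ := funext fun h => extMap_pure h
  map_comp f g := funext fun h => extMap_bind f g h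

/-- The extension of `H_X` to the Kleisli category, `f ↦ λ ∘ H_X f`. -/
def linExtX : KleisliCat M ⥤ KleisliCat M where
  obj Y := (X × (B ⊕ A × Y) : Type u)
  map f := extMapX f
  map_id _ := funext fun h => extMapX_pure h
  map_comp f g := funext fun h => extMapX_bind f g h

/-- The natural transformation between the extensions with components `J π₂`. -/
def projTwoExt : linExtX M A B X ⟶ linExt M A B where
  app Y := (kleisliJ M).map ((projTwo A B X).app Y)
  naturality _ _ f := funext fun h => extMapX_snd f h

/-- The coalgebra `J α⁻¹` on `A* B` in the Kleisli category. -/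
def tracesCoalg : Coalgebra (linExt M A B) where
  V := Traces A B
  str := (kleisliJ M).map (↾(tracesEquiv A B).symm)

/-- The coalgebra `J α⁻¹` on `(X A)* X B` in the Kleisli category. -/
def execsCoalg : Coalgebra (linExtX M A B X) where
  V := Execs A B X
  str := (kleisliJ M).map (↾(execsEquiv A B X).symm)

variable {M A B X}

/-- A function `c : X → M (H X)`, regarded as a coalgebra in the Kleisli category. -/
def toCoalg (c : X → M (B ⊕ A × X)) : Coalgebra (linExt M A B) where
  V := X
  str := c

/-- The coalgebra `c* = stl ∘ ⟨id, c⟩`, which records the current state. -/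
def starCoalg (c : X → M (B ⊕ A × X)) : Coalgebra (linExtX M A B X) where
  V := X
  str := fun x => stl (x, c x)

/-- The trace map of `c`: the unique coalgebra morphism to the final coalgebra. -/
def traceMap (h : IsTerminal (tracesCoalg M A B)) (c : X → M (B ⊕ A × X)) :
    X → M (Traces A B) :=
  (h.from (toCoalg c)).f

/-- The execution map of `c`: the unique coalgebra morphism from `c*` to the final coalgebra. -/
def execMap (h : IsTerminal (execsCoalg M A B X)) (c : X → M (B ⊕ A × X)) :
    X → M (Execs A B X) :=
  (h.from (starCoalg c)).f

/-- The function `f_{π₂} : (X A)* X B → A* B` induced by `π₂`: the unique morphism of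
`H_X`-algebras from the initial `H_X`-algebra to `A* B`, the latter with the structure induced by
`π₂`. -/
def inducedFun (h : IsInitial (execsAlg A B X)) : Execs A B X → Traces A B :=
  (h.to ((Algebra.functorOfNatTrans (projTwo A B X)).obj (tracesAlg A B))).f

/-- The Kleisli morphism induced by `J π₂`: the unique morphism to the final coalgebra on `A* B`
from the coalgebra on `(X A)* X B` with the structure induced by `J π₂`. -/
def inducedKl (h : IsTerminal (tracesCoalg M A B)) : Execs A B X → M (Traces A B) :=
  (h.from ((Coalgebra.functorOfNatTrans (projTwoExt M A B X)).obj (execsCoalg M A B X))).f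

/-- Composition in the Kleisli category. -/
def kcomp {U V W : Type u} (g : V → M W) (f : U → M V) : U → M W :=
  CategoryStruct.comp (obj := KleisliCat M) f g

end Kleisli

end

end GameTraces

namespace GameTraces

/-! ### Finite supports, and the action of the extended functor on sets of traces. -/

section Finality

open HasSupp

/-! Since `tracesEquiv` is a bijection, a coalgebra morphism from `c` to the traces is the same
thing as a fixed point of the monotone operator `traceStep c`, so finality says that this operator
has exactly one fixed point. Both halves rest on one property not contained in `HasSupp`: elements
of `Q` and `D` have finite support.

Existence (`traceFix_eq`) is Kleene's argument. The iterates of the operator from the empty family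
increase, and their union is fixed, because one element of `T` mentions only finitely many
continuations, which all lie in a common stage. Uniqueness (`traceStep_fixedPoint_unique`) holds
because the words in a finite support have bounded length, and each unfolding of a fixed point
strips one letter: membership is decided after finitely many unfoldings. The second finality
statement is an instance of the first, as `H_X` is a linear functor with labels `X × A` and outputs
`X × B`. Initiality of the two algebras is recursion on words.

The comparison is formal and holds for any lawful monad with these final coalgebras. `J` of the
induced function is itself a coalgebra morphism, hence equals the induced Kleisli morphism.
Forgetting the recorded state turns `c*` back into `c`, so the composite with the execution map is a
coalgebra morphism out of `c`, hence the trace map. -/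

theorem EnvKind.supp_finite (e : EnvKind) {X : Type u} (t : e.T X) : (supp t).Finite := by
  cases e
  · exact FinPow.finite t
  · exact Dist.finite t

set_option linter.unusedSectionVars false

variable {T : Type u → Type u} [Monad T] [LawfulMonad T] [HasSupp T] {A B V : Type u}

theorem mem_supp_map {X Y : Type u} (f : X → Y) (t : T X) (y : Y) :
    y ∈ supp (f <$> t) ↔ ∃ x ∈ supp t, f x = y := by
  rw [← bind_pure_comp, supp_bind]
  simp [supp_pure, eq_comm]

theorem mem_map_tracesEquiv_extMap_inl (f : V → Comp T (Traces A B)) (b : B) (t : T (Traces A B)) :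
    t ∈ (tracesEquiv A B <$> extMap f (.inl b : B ⊕ A × V)).sets ↔ t = pure ([], b) := by
  rw [extMap_inl, map_pure]
  exact Iff.rfl

theorem mem_map_tracesEquiv_extMap_inr (f : V → Comp T (Traces A B)) (a : A) (v : V)
    (t : T (Traces A B)) :
    t ∈ (tracesEquiv A B <$> extMap f (.inr (a, v) : B ⊕ A × V)).sets ↔
      ∃ s ∈ (f v).sets, (fun w : Traces A B => (a :: w.1, w.2)) <$> s = t := by
  rw [extMap_inr, ← comp_map]
  exact Iff.rfl

theorem map_tracesEquiv_extMap_mono {f g : V → Comp T (Traces A B)}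
    (h : ∀ v, (f v).sets ⊆ (g v).sets) (z : B ⊕ A × V) :
    (tracesEquiv A B <$> extMap f z).sets ⊆ (tracesEquiv A B <$> extMap g z).sets := by
  rintro t ht
  rcases z with b | ⟨a, v⟩
  · rwa [mem_map_tracesEquiv_extMap_inl] at ht ⊢
  · rw [mem_map_tracesEquiv_extMap_inr] at ht ⊢
    exact ht.imp fun s hs => ⟨h v hs.1, hs.2⟩

/-! ### Coalgebra morphisms as fixed points, and their uniqueness. -/

/-- The operator on families of convex sets of traces whose fixed points are the coalgebra
morphisms from `c` to the coalgebra of traces. -/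
def traceStep (c : V → Comp T (B ⊕ A × V)) (f : V → Comp T (Traces A B)) (v : V) :
    Comp T (Traces A B) :=
  c v >>= fun z => tracesEquiv A B <$> extMap f z

theorem traceStep_mono (c : V → Comp T (B ⊕ A × V)) {f g : V → Comp T (Traces A B)}
    (h : ∀ v, (f v).sets ⊆ (g v).sets) (v : V) :
    (traceStep c f v).sets ⊆ (traceStep c g v).sets := by
  intro t ht
  obtain ⟨s, hs, φ, hφ, rfl⟩ := Comp.mem_bind.1 ht
  exact Comp.mem_bind.2
    ⟨s, hs, φ, fun z hz => map_tracesEquiv_extMap_mono h z (hφ z hz), rfl⟩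

/-- Unfolding both fixed points once with the same `s` and `φ` leaves, on the branches that
continue, sets of words that are one letter shorter, so induction on the length bound applies. The
claim is one-sided; uniqueness follows by using it in both directions. -/
theorem mem_of_length_lt {c : V → Comp T (B ⊕ A × V)} {f g : V → Comp T (Traces A B)}
    (hf : ∀ v, f v = traceStep c f v) (hg : ∀ v, g v = traceStep c g v) (n : ℕ) :
    ∀ (v : V) (t : T (Traces A B)), t ∈ (f v).sets → (∀ w ∈ supp t, w.1.length < n) →
      t ∈ (g v).sets := by
  induction n with
  | zero =>
    intro v t _ hn
    -- No word has length below `0`, and supports are non-empty, so the base case is vacuous.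
    obtain ⟨w, hw⟩ := supp_nonempty t
    exact absurd (hn w hw) (Nat.not_lt_zero _)
  | succ n ih =>
    intro v t ht hn
    rw [hf] at ht
    rw [hg]
    obtain ⟨s, hs, φ, hφ, rfl⟩ := Comp.mem_bind.1 ht
    refine Comp.mem_bind.2 ⟨s, hs, φ, fun z hz => ?_, rfl⟩
    have hz' := hφ z hz
    rcases z with b | ⟨a, y⟩
    · rwa [mem_map_tracesEquiv_extMap_inl] at hz' ⊢
    · rw [mem_map_tracesEquiv_extMap_inr] at hz' ⊢
      obtain ⟨r, hr, hrφ⟩ := hz'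
      refine ⟨r, ih y r hr fun w hw => ?_, hrφ⟩
      -- Every `w` in the support of the continuation `r` yields the word `a w` in the support of `s
      -- >>= φ`, whose length is bounded by hypothesis.
      have := hn (a :: w.1, w.2) (by
        rw [supp_bind]
        refine Set.mem_biUnion hz ?_
        rw [← hrφ]
        exact (mem_supp_map _ _ _).2 ⟨w, hw, rfl⟩)
      exact Nat.lt_of_succ_lt_succ this

/-- The fixed point of `traceStep c` is unique, since the words in a finite support have bounded
length. -/
theorem traceStep_fixedPoint_unique (hT : ∀ {X : Type u} (t : T X), (supp t).Finite)
    {c : V → Comp T (B ⊕ A × V)} {f g : V → Comp T (Traces A B)}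
    (hf : ∀ v, f v = traceStep c f v) (hg : ∀ v, g v = traceStep c g v) : f = g := by
  have bound : ∀ t : T (Traces A B), ∃ n, ∀ w ∈ supp t, w.1.length < n := fun t => by
    obtain ⟨n, hn⟩ := ((hT t).image fun w => w.1.length).bddAbove
    exact ⟨n + 1, fun w hw => Nat.lt_succ_of_le (hn ⟨w, hw, rfl⟩)⟩
  funext v
  refine Comp.ext fun t => ?_
  obtain ⟨n, hn⟩ := bound t
  exact ⟨fun ht => mem_of_length_lt hf hg n v t ht hn, fun ht => mem_of_length_lt hg hf n v t ht hn⟩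

/-! ### Existence of the fixed point by iteration from the empty family. -/

/-- The empty set is convex, since supports are non-empty. -/
def Comp.empty (X : Type u) : Comp T X where
  sets := ∅
  convex := isConvex_iff.2 fun Φ hΦ => by
    obtain ⟨t, ht⟩ := supp_nonempty Φ
    exact (hΦ ht).elim

/-- The traces which are complete after fewer than `n` steps. -/
def traceApprox (c : V → Comp T (B ⊕ A × V)) : ℕ → V → Comp T (Traces A B)
  | 0 => fun _ => Comp.empty _
  | n + 1 => traceStep c (traceApprox c n)

theorem traceApprox_mono (c : V → Comp T (B ⊕ A × V)) (v : V) :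
    Monotone fun n => (traceApprox c n v).sets := by
  refine monotone_nat_of_le_succ fun n => ?_
  induction n generalizing v with
  | zero => exact Set.empty_subset _
  | succ n ih => exact traceStep_mono c ih v

/-- If every element of a finite support satisfies one of an increasing sequence of predicates,
then one of these predicates holds on all of the support. -/
theorem exists_uniform_index (hT : ∀ {X : Type u} (t : T X), (supp t).Finite) {X : Type u} (t : T X)
    {p : ℕ → X → Prop} (hp : ∀ x, Monotone fun n => p n x) (h : ∀ x ∈ supp t, ∃ n, p n x) :
    ∃ n, ∀ x ∈ supp t, p n x := by
  choose! k hk using h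
  obtain ⟨n, hn⟩ := ((hT t).image k).bddAbove
  exact ⟨n, fun x hx => hp x (hn ⟨x, hx, rfl⟩) (hk x hx)⟩

/-- The traces which are complete after finitely many steps. -/
def traceFix (hT : ∀ {X : Type u} (t : T X), (supp t).Finite) (c : V → Comp T (B ⊕ A × V)) (v : V) :
    Comp T (Traces A B) where
  sets := ⋃ n, (traceApprox c n v).sets
  convex := isConvex_iff.2 fun Φ hΦ => by
    -- A union of convex sets need not be convex; here the finite support of `Φ` already lies in a
    -- single stage, and that stage is convex.
    obtain ⟨n, hn⟩ := exists_uniform_index hT Φ (p := fun n t => t ∈ (traceApprox c n v).sets)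
      (fun t _ _ hmn ht => traceApprox_mono c v hmn ht) fun t ht => Set.mem_iUnion.1 (hΦ ht)
    exact Set.mem_iUnion.2 ⟨n, isConvex_iff.1 (traceApprox c n v).convex Φ hn⟩

/-- One inclusion is monotonicity. The other is continuity of `traceStep c` along the chain: the
stages needed for the finitely many points of `supp s` have a common upper bound `n`, so the element
appears at stage `n + 1`. -/
theorem traceFix_eq (hT : ∀ {X : Type u} (t : T X), (supp t).Finite) (c : V → Comp T (B ⊕ A × V))
    (v : V) : traceFix hT c v = traceStep c (traceFix hT c) v := by
  refine Comp.ext fun t => ⟨fun ht => ?_, fun ht => ?_⟩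
  · obtain ⟨n, hn⟩ := Set.mem_iUnion.1 ht
    have hn' : t ∈ (traceApprox c (n + 1) v).sets := traceApprox_mono c v n.le_succ hn
    exact traceStep_mono c (fun v => Set.subset_iUnion (fun n => (traceApprox c n v).sets) n) v hn'
  · obtain ⟨s, hs, φ, hφ, rfl⟩ := Comp.mem_bind.1 ht
    obtain ⟨n, hn⟩ := exists_uniform_index hT s
      (p := fun n z => φ z ∈ (tracesEquiv A B <$> extMap (traceApprox c n) z).sets)
      (fun z _ _ hmn hz => map_tracesEquiv_extMap_mono (fun v => traceApprox_mono c v hmn) z hz)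
      (fun z hz => by
        have hz' := hφ z hz
        rcases z with b | ⟨a, y⟩
        · exact ⟨0, by rwa [mem_map_tracesEquiv_extMap_inl] at hz' ⊢⟩
        · rw [mem_map_tracesEquiv_extMap_inr] at hz'
          obtain ⟨r, hr, hrφ⟩ := hz'
          obtain ⟨n, hn⟩ := Set.mem_iUnion.1 hr
          exact ⟨n, (mem_map_tracesEquiv_extMap_inr _ _ _ _).2 ⟨r, hn, hrφ⟩⟩)
    exact Set.mem_iUnion.2 ⟨n + 1, Comp.mem_bind.2 ⟨s, hs, φ, hn, rfl⟩⟩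

/-- Transposing the coalgebra square along the bijection `σ` turns it into an equation solved for
`t`, the fixed-point form. -/
theorem bind_eq_bind_pure_symm_iff {M : Type u → Type u} [Monad M] [LawfulMonad M]
    {U Y Z : Type u} (σ : Y ≃ Z) (m : M U) (k : U → M Y) (t : M Z) :
    (m >>= k) = (t >>= fun w => pure (σ.symm w)) ↔ t = m >>= fun u => σ <$> k u := by
  rw [bind_pure_comp, ← map_bind]
  constructor
  · intro h
    rw [h, ← comp_map]
    simp [Function.comp_def]
  · rintro rfl
    rw [← comp_map]
    simp [Function.comp_def]

/-- The coalgebra morphisms to the coalgebra of traces are the fixed points of `traceStep`. -/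
theorem existsUnique_traces (hT : ∀ {X : Type u} (t : T X), (supp t).Finite)
    (c : V → Comp T (B ⊕ A × V)) :
    ∃! f : V → Comp T (Traces A B), ∀ v,
      (c v >>= extMap f) = (f v >>= fun w => pure ((tracesEquiv A B).symm w)) := by
  simp only [bind_eq_bind_pure_symm_iff]
  exact ⟨traceFix hT c, traceFix_eq hT c, fun g hg =>
    traceStep_fixedPoint_unique hT hg (traceFix_eq hT c)⟩

/-! ### Executions as traces over enlarged alphabets. -/

/-- The bijection `X × (B + A × Y) ≅ X × B + (X × A) × Y`. -/
def distribEquiv (A B X Y : Type u) : X × (B ⊕ A × Y) ≃ (X × B) ⊕ (X × A) × Y where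
  toFun
    | (x, .inl b) => .inl (x, b)
    | (x, .inr (a, y)) => .inr ((x, a), y)
  invFun
    | .inl (x, b) => (x, .inl b)
    | .inr ((x, a), y) => (x, .inr (a, y))
  left_inv := by rintro ⟨_, (_ | ⟨_, _⟩)⟩ <;> rfl
  right_inv := by rintro (⟨_, _⟩ | ⟨⟨_, _⟩, _⟩) <;> rfl

/-- This is naturality of `distribEquiv` for Kleisli morphisms: it identifies the extension of `H_X`
with the extension of the linear functor with labels `X × A` and outputs `X × B`. -/
theorem map_distribEquiv_extMapX {M : Type u → Type u} [Monad M] [LawfulMonad M] {X Y Z : Type u}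
    (f : Y → M Z) (h : X × (B ⊕ A × Y)) :
    distribEquiv A B X Z <$> extMapX f h = extMap f (distribEquiv A B X Y h) := by
  rcases h with ⟨x, b | ⟨a, y⟩⟩
  · simp [extMapX_mk, extMap_inl, distribEquiv]
  · simp [extMapX_mk, extMap_inr, distribEquiv]

/-- `Execs A B X` unfolds to `Traces (X × A) (X × B)`, so relabelling `c` along `distribEquiv`
reduces the claim to the one for traces. -/
theorem existsUnique_execs (hT : ∀ {X : Type u} (t : T X), (supp t).Finite) {X : Type u}
    (c : V → Comp T (X × (B ⊕ A × V))) :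
    ∃! f : V → Comp T (Execs A B X), ∀ v,
      (c v >>= extMapX f) = (f v >>= fun w => pure ((execsEquiv A B X).symm w)) := by
  have key : ∀ f : V → Comp T (Execs A B X),
      (∀ v, (c v >>= extMapX f) = (f v >>= fun w => pure ((execsEquiv A B X).symm w))) ↔
      ∀ v, ((distribEquiv A B X V <$> c v) >>= extMap f) =
        (f v >>= fun w => pure ((tracesEquiv (X × A) (X × B)).symm w)) := by
    intro f
    simp only [bind_eq_bind_pure_symm_iff, bind_map_left]
    refine forall_congr' fun v => ?_
    have : ∀ z, execsEquiv A B X <$> extMapX f z =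
        tracesEquiv (X × A) (X × B) <$> extMap f (distribEquiv A B X V z) := by
      intro z
      rw [← map_distribEquiv_extMapX, ← comp_map]
      congr 1
      -- The two word structures correspond under `distribEquiv`, by computation on each
      -- constructor.
      funext p
      rcases p with ⟨x, b | ⟨a, y⟩⟩ <;> rfl
    simp only [this]
  simp only [key]
  exact existsUnique_traces hT _

end Finality

/-! ### Initial algebras and final coalgebras. -/

section Universal

variable (A B X : Type u)

/-- The morphism to `K` is the right fold, started at the value of the final output; a homomorphism
obeys the same recursion, so induction on the word gives uniqueness. -/
theorem nonempty_isInitial_tracesAlg : Nonempty (IsInitial (tracesAlg A B)) := by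
  refine ⟨IsInitial.ofUniqueHom (fun K => ⟨↾(fun w : Traces A B =>
    w.1.foldr (fun a v => K.str (.inr (a, v))) (K.str (.inl w.2))), ?_⟩) fun K m => ?_⟩
  · ext (b | ⟨a, l, b⟩) <;> rfl
  · have hm (z : B ⊕ A × Traces A B) : K.str ((linFun A B).map m.f z) = m.f (tracesEquiv A B z) :=
      ConcreteCategory.congr_hom m.h z
    ext ⟨l, b⟩
    induction l with
    | nil => exact (hm (.inl b)).symm
    | cons a l ih =>
      exact (hm (.inr (a, (l, b)))).symm.trans (congrArg (fun v => K.str (.inr (a, v))) ih)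

theorem nonempty_isInitial_execsAlg : Nonempty (IsInitial (execsAlg A B X)) := by
  refine ⟨IsInitial.ofUniqueHom (fun K => ⟨↾(fun w : Execs A B X =>
    w.1.foldr (fun p v => K.str (p.1, .inr (p.2, v))) (K.str (w.2.1, .inl w.2.2))), ?_⟩)
    fun K m => ?_⟩
  · ext ⟨x, b | ⟨a, l, e⟩⟩ <;> rfl
  · have hm (z : X × (B ⊕ A × Execs A B X)) :
        K.str ((linFunX A B X).map m.f z) = m.f (execsEquiv A B X z) :=
      ConcreteCategory.congr_hom m.h z
    ext ⟨l, x, b⟩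
    induction l with
    | nil => exact (hm (x, .inl b)).symm
    | cons p l ih =>
      exact (hm (p.1, .inr (p.2, (l, (x, b))))).symm.trans
        (congrArg (fun v => K.str (p.1, .inr (p.2, v))) ih)

variable {T : Type u → Type u} [Monad T] [LawfulMonad T] [HasSupp T]

theorem nonempty_isTerminal_tracesCoalg
    (hT : ∀ {X : Type u} (t : T X), (HasSupp.supp t).Finite) :
    Nonempty (IsTerminal (tracesCoalg (Comp T) A B)) := by
  have h (c : Coalgebra (linExt (Comp T) A B)) := existsUnique_traces (V := c.V) hT c.str
  choose f hf hu using h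
  exact ⟨IsTerminal.ofUniqueHom (fun c => ⟨f c, funext (hf c)⟩) fun c m =>
    Coalgebra.Hom.ext (hu c m.f (congrFun m.h))⟩

theorem nonempty_isTerminal_execsCoalg
    (hT : ∀ {X : Type u} (t : T X), (HasSupp.supp t).Finite) :
    Nonempty (IsTerminal (execsCoalg (Comp T) A B X)) := by
  have h (c : Coalgebra (linExtX (Comp T) A B X)) := existsUnique_execs (V := c.V) hT c.str
  choose f hf hu using h
  exact ⟨IsTerminal.ofUniqueHom (fun c => ⟨f c, funext (hf c)⟩) fun c m =>
    Coalgebra.Hom.ext (hu c m.f (congrFun m.h))⟩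

end Universal

/-! ### Comparison of executions with traces, over an arbitrary lawful monad. -/

section Comparison

variable {M : Type u → Type u} [Monad M] [LawfulMonad M] {A B X : Type u}

theorem extMap_pure_comp {Y Z : Type u} (f : Y → Z) (h : B ⊕ A × Y) :
    extMap (fun y => (pure (f y) : M Z)) h = pure (Sum.map id (Prod.map id f) h) := by
  rcases h with b | ⟨a, y⟩
  · rfl
  · simp [extMap_inr]

/-- This is the homomorphism square of the induced function, evaluated at a point; it gives the
recursion that erases states from an execution. -/
theorem inducedFun_execsEquiv (h : IsInitial (execsAlg A B X)) (z : X × (B ⊕ A × Execs A B X)) :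
    inducedFun h (execsEquiv A B X z) =
      tracesEquiv A B (Sum.map id (Prod.map id (inducedFun h)) z.2) :=
  (ConcreteCategory.congr_hom
    (h.to ((Algebra.functorOfNatTrans (projTwo A B X)).obj (tracesAlg A B))).h z).symm

theorem inducedKl_eq_map_inducedFun (h : IsInitial (execsAlg A B X))
    (t : IsTerminal (tracesCoalg M A B)) :
    inducedKl t = (kleisliJ M).map (↾(inducedFun h)) := by
  -- `J` of the induced function is a coalgebra morphism: on pure values the square reduces to the
  -- recursion above, with `w` rewritten as the image of its decomposition.
  let m : (Coalgebra.functorOfNatTrans (projTwoExt M A B X)).obj (execsCoalg M A B X) ⟶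
      tracesCoalg M A B := by
    refine ⟨(kleisliJ M).map (↾(inducedFun h)), funext fun w => ?_⟩
    change ((pure ((execsEquiv A B X).symm w) >>= fun z => pure z.2) >>=
        extMap fun w => (pure (inducedFun h w) : M (Traces A B))) =
      (pure (inducedFun h w) >>= fun w => pure ((tracesEquiv A B).symm w))
    rw [pure_bind, pure_bind, pure_bind, extMap_pure_comp]
    conv_rhs => rw [← (execsEquiv A B X).apply_symm_apply w, inducedFun_execsEquiv,
      Equiv.symm_apply_apply]
  exact congrArg Coalgebra.Hom.f (t.hom_ext (t.from _) m)

/-- The transfer along `J π₂` is functorial, so it carries the execution map to a coalgebra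
morphism; composing with the induced morphism gives a second arrow from `c` to the final coalgebra.
-/
theorem kcomp_inducedKl_execMap (t : IsTerminal (tracesCoalg M A B))
    (tX : IsTerminal (execsCoalg M A B X)) (c : X → M (B ⊕ A × X)) :
    kcomp (inducedKl t) (execMap tX c) = traceMap t c := by
  -- The transferred coalgebra of `c*` is `c` again, though not definitionally, so the identity on
  -- `X` is used as a coalgebra morphism between them.
  let i : toCoalg c ⟶ (Coalgebra.functorOfNatTrans (projTwoExt M A B X)).obj (starCoalg c) := by
    refine ⟨𝟙 (toCoalg c).V, ?_⟩
    have hc : c = fun x => stl (x, c x) >>= fun p => pure p.2 := by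
      funext x
      simp [stl]
    exact ((congrArg ((toCoalg c).str ≫ ·) ((linExt M A B).map_id (toCoalg c).V)).trans
      (Category.comp_id (X := (toCoalg c).V) _)).trans (hc.trans (Category.id_comp (X := (toCoalg c).V) _).symm)
  have h := congrArg Coalgebra.Hom.f (t.hom_ext
    (i ≫ (Coalgebra.functorOfNatTrans (projTwoExt M A B X)).map (tX.from (starCoalg c)) ≫
      t.from _) (t.from (toCoalg c)))
  -- The composite in `h` starts with the identity underlying `i`, which the unit law removes.
  exact (Category.id_comp (X := (toCoalg c).V) _).symm.trans h

end Comparison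

end GameTraces

theorem mainTheorem7 (e : GameTraces.EnvKind) (A B X : Type u) :
    ∃ (_ : IsInitial (GameTraces.tracesAlg A B))
      (iHX : IsInitial (GameTraces.execsAlg A B X))
      (tH : IsTerminal (GameTraces.tracesCoalg (GameTraces.Comp e.T) A B))
      (tHX : IsTerminal (GameTraces.execsCoalg (GameTraces.Comp e.T) A B X)),
      GameTraces.inducedKl tH =
        (GameTraces.kleisliJ (GameTraces.Comp e.T)).map (↾(GameTraces.inducedFun iHX)) ∧
      ∀ c : X → GameTraces.Comp e.T (B ⊕ A × X),
        GameTraces.kcomp (GameTraces.inducedKl tH) (GameTraces.execMap tHX c) =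
          GameTraces.traceMap tH c := by
  have hT {X : Type u} (t : e.T X) := e.supp_finite t
  obtain ⟨iH⟩ := GameTraces.nonempty_isInitial_tracesAlg A B
  obtain ⟨iHX⟩ := GameTraces.nonempty_isInitial_execsAlg A B X
  obtain ⟨tH⟩ := GameTraces.nonempty_isTerminal_tracesCoalg A B hT
  obtain ⟨tHX⟩ := GameTraces.nonempty_isTerminal_execsCoalg A B X hT
  exact ⟨iH, iHX, tH, tHX, GameTraces.inducedKl_eq_map_inducedFun iHX tH,
    GameTraces.kcomp_inducedKl_execMap tH tHX⟩
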